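/- Let $d\geq 1$, $b:\mathbb R^d\to\mathbb R^d$, $\sigma\in\mathbb R^{d\times d}$ (possibly singular), let $B$ be a $d$-dimensional Brownian motion, and for each $x\in\mathbb R^d$ let $X$ be, under $\mathbb P_x$, the solution of $$\mathrm dX_t=b(X_t)\,\mathrm dt+\sigma\,\mathrm dB_t,\qquad X_0=x .$$ For a continuous path $y$ let $\Phi^y_t\in\mathbb R^{d\times d}$ solve $\partial_t\Phi^y_t=\nabla b(y(t))\Phi^y_t$, $\Phi^y_0=\mathrm{Id}$, and let $|\Phi|$ denote the operator norm associated with the Euclidean norm. For $t\ge 0$ and $p\geq 1$ set $$\kappa_p(t)=\sup_{x\in\mathbb R^d,\,|v|=1}\left(\mathbb E_x|\Phi^X_tv|^p\right)^{1/p},\qquad \overline\kappa_\infty(t)=\sup\{|\Phi^\gamma_t| : \gamma\in\mathcal A(t)\},$$ $$\mathcal A(t)=\left\{\gamma\in\mathcal C([0,t],\mathbb R^d):\ \forall\varepsilon>0,\ \mathbb P_{\gamma(0)}\left(|X_s-\gamma(s)|\le\varepsilon\ \forall s\in[0,t]\right)>0\right\}.$$ Assume that: - $b$ is $\mathcal C^2$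 with bounded second-order derivatives, and there exists $L>0$ such that $(x-y)\cdot(b(x)-b(y))\le L|x-y|^2$ for all $x,y\in\mathbb R^d$; - for all $x,y\in\mathbb R^d$ and $t,\varepsilon>0$, $\mathbb P_x(|X_t-y|\le\varepsilon)>0$; - either $\nabla b$ is bounded, or for all $x,y\in\mathbb R^d$ there exists $R>0$ such that for all $t,\varepsilon>0$, $\mathbb P_x\left(|X_t-y|\le\varepsilon\text{ and }|X_s|\le R\ \forall s\in[0,t]\right)>0$. Then, for every $t\ge 0$ and $x\in\mathbb R^d$, the following limit exists, is finite, and satisfies $$\lim_{p\to\infty}\ \sup_{|v|=1}\left(\mathbb E_x|\Phi^X_tv|^p\right)^{1/p}\ \ge\ \overline\kappa_\infty(t).$$ Moreover, for every $t\geq 0$, the limit $\lim_{p\to\infty}\kappa_p(t)$ exists, is finite, and satisfies $\lim_{p\to\infty}\kappa_p(t)\ge\overline\kappa_\infty(t)$. -/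

import Mathlib

open MeasureTheory ProbabilityTheory Filter Topology
open scoped NNReal ENNReal

noncomputable section

/-- The basic conditions on the drift: `b` is of class `C²` with bounded second-order derivatives,
and it is one-sided Lipschitz for some constant `L > 0`. -/
structure BasicConditions {d : ℕ}
    (b : EuclideanSpace ℝ (Fin d) → EuclideanSpace ℝ (Fin d)) : Prop where
  contDiff : ContDiff ℝ 2 b
  bounded_second_deriv : ∃ C : ℝ, ∀ x, ‖fderiv ℝ (fderiv ℝ b) x‖ ≤ C
  one_sided_lipschitz : ∃ L : ℝ, 0 < L ∧ ∀ x y, inner ℝ (x - y) (b x - b y) ≤ L * ‖x - y‖ ^ 2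

/-- `B` is a standard `d`-dimensional Brownian motion with respect to the filtration `ℱ`: its
coordinates are independent standard real Brownian motions, it is adapted to `ℱ`, and for every
time `s` the process of its increments after `s` is independent of `ℱ s`. -/
structure IsFilteredBrownianMotion {Ω : Type*} {mΩ : MeasurableSpace Ω} {d : ℕ}
    (ℱ : Filtration ℝ≥0 mΩ) (B : ℝ≥0 → Ω → EuclideanSpace ℝ (Fin d)) (P : Measure Ω) : Prop where
  isBrownian : ∀ i, IsBrownianReal (fun t ω ↦ B t ω i) P
  indep_coord : iIndepFun (fun (i : Fin d) (ω : Ω) (t : ℝ≥0) ↦ B t ω i) P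
  adapted : ∀ t, Measurable[ℱ t] (B t)
  indep_increments : ∀ s : ℝ≥0,
    Indep (MeasurableSpace.comap (fun (ω : Ω) (t : ℝ≥0) ↦ B (s + t) ω - B s ω) inferInstance)
      (ℱ s) P

/-- `X` is a solution of `dX_t = b(X_t) dt + σ dB_t` with `X_0 = x`: it is adapted and, almost
surely, it has continuous paths and solves the equation in integral form. -/
structure IsSDESolution {Ω : Type*} {mΩ : MeasurableSpace Ω} {d : ℕ}
    (b : EuclideanSpace ℝ (Fin d) → EuclideanSpace ℝ (Fin d)) (σ : Matrix (Fin d) (Fin d) ℝ)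
    (ℱ : Filtration ℝ≥0 mΩ) (B : ℝ≥0 → Ω → EuclideanSpace ℝ (Fin d)) (P : Measure Ω)
    (x : EuclideanSpace ℝ (Fin d)) (X : ℝ≥0 → Ω → EuclideanSpace ℝ (Fin d)) : Prop where
  adapted : ∀ t, Measurable[ℱ t] (X t)
  continuous_paths : ∀ᵐ ω ∂P, Continuous (fun t ↦ X t ω)
  equation : ∀ᵐ ω ∂P, ∀ t : ℝ≥0,
    X t ω = x + (∫ s in (0 : ℝ)..t, b (X s.toNNReal ω))
      + Matrix.toEuclideanCLM (n := Fin d) (𝕜 := ℝ) σ (B t ω)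

/-- `Φ` solves `∂ₜ Φ_t = ∇b(y(t)) Φ_t` on `[0, T]` with `Φ_0 = Id`. -/
def IsLinearizedFlow {d : ℕ} (b : EuclideanSpace ℝ (Fin d) → EuclideanSpace ℝ (Fin d))
    (y : ℝ≥0 → EuclideanSpace ℝ (Fin d)) (T : ℝ≥0)
    (Φ : ℝ → EuclideanSpace ℝ (Fin d) →L[ℝ] EuclideanSpace ℝ (Fin d)) : Prop :=
  Φ 0 = ContinuousLinearMap.id ℝ (EuclideanSpace ℝ (Fin d)) ∧
    ∀ t ∈ Set.Icc (0 : ℝ) T,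
      HasDerivWithinAt Φ ((fderiv ℝ b (y t.toNNReal)).comp (Φ t)) (Set.Icc (0 : ℝ) T) t

open Classical in
/-- The linearized flow `Φ_T^y` at time `T` along the path `y`: the value at `T` of the (unique)
solution of the linear equation on `[0, T]`, which exists as soon as `b` is `C¹` and `y` is
continuous on `[0, T]`. -/
def linearizedFlow {d : ℕ} (b : EuclideanSpace ℝ (Fin d) → EuclideanSpace ℝ (Fin d))
    (y : ℝ≥0 → EuclideanSpace ℝ (Fin d)) (T : ℝ≥0) :
    EuclideanSpace ℝ (Fin d) →L[ℝ] EuclideanSpace ℝ (Fin d) :=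
  if h : ∃ Φ, IsLinearizedFlow b y T Φ then h.choose T else 0

/- In what follows, `X x` is the process started at `x`, so that `P {ω | ... X x ... ω ...}` is the
probability `ℙ_x` of the corresponding event. -/

/-- Controllability. -/
def IsControllable {Ω : Type*} {mΩ : MeasurableSpace Ω} {d : ℕ} (P : Measure Ω)
    (X : EuclideanSpace ℝ (Fin d) → ℝ≥0 → Ω → EuclideanSpace ℝ (Fin d)) : Prop :=
  ∀ x y : EuclideanSpace ℝ (Fin d), ∀ t : ℝ≥0, 0 < t → ∀ ε : ℝ, 0 < ε →
    0 < P {ω | ‖X x t ω - y‖ ≤ ε}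

/-- Controllability within bounded tubes: the radius `R` depends only on the endpoints. -/
def IsControllableInTubes {Ω : Type*} {mΩ : MeasurableSpace Ω} {d : ℕ} (P : Measure Ω)
    (X : EuclideanSpace ℝ (Fin d) → ℝ≥0 → Ω → EuclideanSpace ℝ (Fin d)) : Prop :=
  ∀ x y : EuclideanSpace ℝ (Fin d), ∃ R : ℝ, 0 < R ∧
    ∀ t : ℝ≥0, 0 < t → ∀ ε : ℝ, 0 < ε →
      0 < P {ω | ‖X x t ω - y‖ ≤ ε ∧ ∀ s ≤ t, ‖X x s ω‖ ≤ R}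

/-- The set of admissible paths on `[0, T]` (only the values of `γ` on `[0, T]` matter). -/
def admissiblePaths {Ω : Type*} {mΩ : MeasurableSpace Ω} {d : ℕ} (P : Measure Ω)
    (X : EuclideanSpace ℝ (Fin d) → ℝ≥0 → Ω → EuclideanSpace ℝ (Fin d)) (T : ℝ≥0) :
    Set (ℝ≥0 → EuclideanSpace ℝ (Fin d)) :=
  {γ | ContinuousOn γ (Set.Icc 0 T) ∧
    ∀ ε : ℝ, 0 < ε → 0 < P {ω | ∀ t ≤ T, ‖X (γ 0) t ω - γ t‖ ≤ ε}}

/-- The supremum of the operator norms of the linearized flows along admissible paths. -/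
def kappaBar {Ω : Type*} {mΩ : MeasurableSpace Ω} {d : ℕ}
    (b : EuclideanSpace ℝ (Fin d) → EuclideanSpace ℝ (Fin d)) (P : Measure Ω)
    (X : EuclideanSpace ℝ (Fin d) → ℝ≥0 → Ω → EuclideanSpace ℝ (Fin d)) (T : ℝ≥0) : ℝ≥0∞ :=
  ⨆ γ ∈ admissiblePaths P X T, ‖linearizedFlow b γ T‖ₑ

/-- `sup_{|v| = 1} 𝔼_x[|Φ_t^X v|^p]^{1/p}`, for a fixed starting point `x`. -/
def kappaAt {Ω : Type*} {mΩ : MeasurableSpace Ω} {d : ℕ}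
    (b : EuclideanSpace ℝ (Fin d) → EuclideanSpace ℝ (Fin d)) (P : Measure Ω)
    (X : EuclideanSpace ℝ (Fin d) → ℝ≥0 → Ω → EuclideanSpace ℝ (Fin d))
    (p : ℝ) (t : ℝ≥0) (x : EuclideanSpace ℝ (Fin d)) : ℝ≥0∞ :=
  ⨆ v ∈ Metric.sphere (0 : EuclideanSpace ℝ (Fin d)) 1,
    (∫⁻ ω, ‖linearizedFlow b (fun s ↦ X x s ω) t v‖ₑ ^ p ∂P) ^ (1 / p)

/-- `κ_p(t) = sup_{x, |v| = 1} 𝔼_x[|Φ_t^X v|^p]^{1/p}`. -/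
def kappa {Ω : Type*} {mΩ : MeasurableSpace Ω} {d : ℕ}
    (b : EuclideanSpace ℝ (Fin d) → EuclideanSpace ℝ (Fin d)) (P : Measure Ω)
    (X : EuclideanSpace ℝ (Fin d) → ℝ≥0 → Ω → EuclideanSpace ℝ (Fin d))
    (p : ℝ) (t : ℝ≥0) : ℝ≥0∞ :=
  ⨆ x : EuclideanSpace ℝ (Fin d), kappaAt b P X p t x

end

/-! The `p`-th moments increase with `p` since `P` is a probability, and the one-sided Lipschitz
bound gives `|Φ_t v| ≤ exp (L t) |v|` along every path. So both limits exist and are finite.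

For the lower bound, fix an admissible `γ` and a start `x`. During a short time `h` the process is
steered near `γ 0` with `∇b` bounded by a constant independent of `h`; afterwards it follows `γ`
with delay `h`. The initial stretch changes the flow by `O(exp (K h) - 1)`, and uniform continuity
of `γ` absorbs the delay. Hence `Φ^X` is close to `Φ^γ` with positive probability
(`exists_measurableSet_linearizedFlow_close`), and a lower bound on such an event survives `p → ∞`.

Following `γ` after time `h` would usually be the Markov property. Here admissibility is turned into
a statement about the noise alone (`measure_noise_close_pos`), carried to time `h` by stationary
independent increments, and turned back into closeness of paths by
`norm_sub_le_of_integral_equation`. No invertibility of `σ` enters. -/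

section LinearODE

/-! ### Global solutions of linear differential equations. -/

variable {F : Type*} [NormedAddCommGroup F] [NormedSpace ℝ F]

/-- Concatenation of two solutions of an ordinary differential equation. -/
lemma exists_hasDerivWithinAt_glue {f : ℝ → F → F} {a b c : ℝ} (hab : a ≤ b) (hbc : b ≤ c)
    {u v : ℝ → F} (huv : u b = v b)
    (hu : ∀ t ∈ Set.Icc a b, HasDerivWithinAt u (f t (u t)) (Set.Icc a b) t)
    (hv : ∀ t ∈ Set.Icc b c, HasDerivWithinAt v (f t (v t)) (Set.Icc b c) t) :
    ∃ w : ℝ → F, w a = u a ∧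
      ∀ t ∈ Set.Icc a c, HasDerivWithinAt w (f t (w t)) (Set.Icc a c) t := by
  classical
  let w : ℝ → F := fun t ↦ if t ≤ b then u t else v t
  have hwu : ∀ t ∈ Set.Icc a b, w t = u t := fun t ht ↦ if_pos ht.2
  have hwv : ∀ t ∈ Set.Icc b c, w t = v t := by
    intro t ht
    rcases eq_or_lt_of_le ht.1 with h | h
    · subst h; simp [w, huv]
    · exact if_neg (not_le.2 h)
  refine ⟨w, hwu a ⟨le_rfl, hab⟩, fun t ht ↦ ?_⟩
  rw [← Set.Icc_union_Icc_eq_Icc hab hbc]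
  refine HasDerivWithinAt.union ?_ ?_
  · by_cases h : t ∈ Set.Icc a b
    · rw [hwu t h]
      exact (hu t h).congr_of_mem hwu h
    · exact HasFDerivWithinAt.of_notMem_closure (by rwa [isClosed_Icc.closure_eq])
  · by_cases h : t ∈ Set.Icc b c
    · rw [hwv t h]
      exact (hv t h).congr_of_mem hwv h
    · exact HasFDerivWithinAt.of_notMem_closure (by rwa [isClosed_Icc.closure_eq])

variable [CompleteSpace F]

/-- A linear equation with bounded coefficients has solutions on short intervals, of a length that
does not depend on the initial condition. -/
lemma exists_linear_ode_local {A : ℝ → F →L[ℝ] F} {K : ℝ≥0} (hA : Continuous A)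
    (hK : ∀ t, ‖A t‖ ≤ K) (a : ℝ) {τ : ℝ} (hτ : 0 ≤ τ) (hKτ : 2 * K * τ ≤ 1) (x : F) :
    ∃ u : ℝ → F, u a = x ∧
      ∀ t ∈ Set.Icc a (a + τ), HasDerivWithinAt u (A t (u t)) (Set.Icc a (a + τ)) t := by
  have ha : a ∈ Set.Icc a (a + τ) := ⟨le_rfl, by linarith⟩
  -- On the ball of radius `‖x‖` around `x` the field is at most `2 K ‖x‖`; both scale with `x`, so
  -- the admissible length does not depend on it.
  have hp : IsPicardLindelof (fun t v ↦ A t v) (⟨a, ha⟩ : Set.Icc a (a + τ)) x ‖x‖₊ 0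
      (K * (2 * ‖x‖₊)) K := by
    refine ⟨fun t _ ↦ ?_, fun v _ ↦ ?_, fun t _ v hv ↦ ?_, ?_⟩
    · exact ((A t).lipschitz.weaken (hK t)).lipschitzOnWith
    · exact (hA.clm_apply continuous_const).continuousOn
    · have h1 : ‖v‖ ≤ 2 * ‖x‖ := by
        have := norm_le_norm_add_norm_sub' v x
        rw [Metric.mem_closedBall, dist_eq_norm] at hv
        have hv' : ‖v - x‖ ≤ ‖x‖ := hv
        linarith
      calc ‖A t v‖ ≤ ‖A t‖ * ‖v‖ := (A t).le_opNorm v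
        _ ≤ K * (2 * ‖x‖) := by gcongr; exact hK t
        _ = _ := by simp
    · have : max (a + τ - a) (a - a) = τ := by simp [hτ]
      simp only [this]
      push_cast
      simp only [sub_zero]
      nlinarith [norm_nonneg x]
  exact hp.exists_eq_forall_mem_Icc_hasDerivWithinAt₀

/-- Global existence for linear ordinary differential equations. -/
lemma exists_linear_ode {A : ℝ → F →L[ℝ] F} {K : ℝ≥0} (hA : Continuous A)
    (hK : ∀ t, ‖A t‖ ≤ K) {T : ℝ} (hT : 0 ≤ T) (x : F) :
    ∃ u : ℝ → F, u 0 = x ∧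
      ∀ t ∈ Set.Icc 0 T, HasDerivWithinAt u (A t (u t)) (Set.Icc 0 T) t := by
  obtain ⟨N, hN⟩ := exists_nat_ge (2 * K * T)
  -- `N` may be zero, hence `N + 1` steps.
  set τ : ℝ := T / (N + 1) with hτdef
  have hN0 : (0 : ℝ) < N + 1 := by positivity
  have hτ : 0 ≤ τ := by positivity
  have hKτ : 2 * K * τ ≤ 1 := by
    rw [hτdef, ← mul_div_assoc, div_le_one hN0]
    linarith
  have key : ∀ n : ℕ, ∃ u : ℝ → F, u 0 = x ∧
      ∀ t ∈ Set.Icc 0 (n * τ), HasDerivWithinAt u (A t (u t)) (Set.Icc 0 (n * τ)) t := by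
    intro n
    induction n with
    | zero =>
      refine ⟨fun _ ↦ x, rfl, fun t ht ↦ ?_⟩
      simp only [Nat.cast_zero, zero_mul, Set.Icc_self, Set.mem_singleton_iff] at ht ⊢
      subst ht
      exact HasFDerivWithinAt.of_subsingleton Set.subsingleton_singleton
    | succ n ih =>
      obtain ⟨u, hu0, hu⟩ := ih
      obtain ⟨v, hv0, hv⟩ := exists_linear_ode_local hA hK (n * τ) hτ hKτ (u (n * τ))
      obtain ⟨w, hw0, hw⟩ := exists_hasDerivWithinAt_glue (f := fun t v ↦ A t v)
        (by positivity) (by linarith) hv0.symm hu hv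
      refine ⟨w, hw0.trans hu0, ?_⟩
      have : ((n + 1 : ℕ) : ℝ) * τ = n * τ + τ := by push_cast; ring
      rwa [this]
  have hNT : ((N + 1 : ℕ) : ℝ) * τ = T := by
    rw [hτdef]; push_cast; field_simp
  simpa only [hNT] using key (N + 1)

end LinearODE

/-! ### The linearized flow: existence, growth and stability. -/

section Flow

variable {d : ℕ} {b : EuclideanSpace ℝ (Fin d) → EuclideanSpace ℝ (Fin d)}

lemma BasicConditions.differentiable (hb : BasicConditions b) : Differentiable ℝ b :=
  hb.contDiff.differentiable (by norm_num)

lemma BasicConditions.continuous_fderiv (hb : BasicConditions b) : Continuous (fderiv ℝ b) :=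
  hb.contDiff.continuous_fderiv (by norm_num)

lemma BasicConditions.exists_norm_fderiv_sub_le (hb : BasicConditions b) :
    ∃ C : ℝ, 0 ≤ C ∧ ∀ x y, ‖fderiv ℝ b x - fderiv ℝ b y‖ ≤ C * ‖x - y‖ := by
  obtain ⟨C, hC⟩ := hb.bounded_second_deriv
  refine ⟨C, le_trans (norm_nonneg (fderiv ℝ (fderiv ℝ b) 0)) (hC 0), fun x y ↦ ?_⟩
  have hd : Differentiable ℝ (fderiv ℝ b) :=
    (hb.contDiff.fderiv_right (m := 1) (by norm_num)).differentiable (by norm_num)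
  exact Convex.norm_image_sub_le_of_norm_fderiv_le (𝕜 := ℝ) (s := Set.univ)
    (fun z _ ↦ hd z) (fun z _ ↦ hC z) convex_univ (Set.mem_univ y) (Set.mem_univ x)

lemma BasicConditions.exists_norm_fderiv_le (hb : BasicConditions b) (M : ℝ) :
    ∃ K : ℝ, 0 < K ∧ ∀ x, ‖x‖ ≤ M → ‖fderiv ℝ b x‖ ≤ K := by
  obtain ⟨C, hC0, hC⟩ := hb.exists_norm_fderiv_sub_le
  refine ⟨‖fderiv ℝ b 0‖ + C * |M| + 1, by positivity, fun x hx ↦ ?_⟩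
  have h1 := hC x 0
  have h2 := norm_le_norm_add_norm_sub' (fderiv ℝ b x) (fderiv ℝ b 0)
  rw [sub_zero] at h1
  have h3 : C * ‖x‖ ≤ C * |M| := by gcongr; exact hx.trans (le_abs_self M)
  linarith

/-- The drift is Lipschitz on every ball. -/
lemma BasicConditions.exists_norm_sub_le (hb : BasicConditions b) (M : ℝ) :
    ∃ K : ℝ, 0 < K ∧ ∀ x y, ‖x‖ ≤ M → ‖y‖ ≤ M → ‖b x - b y‖ ≤ K * ‖x - y‖ := by
  obtain ⟨K, hK0, hK⟩ := hb.exists_norm_fderiv_le M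
  refine ⟨K, hK0, fun x y hx hy ↦ ?_⟩
  exact Convex.norm_image_sub_le_of_norm_fderiv_le (𝕜 := ℝ) (s := Metric.closedBall 0 M)
    (fun z _ ↦ hb.differentiable z) (fun z hz ↦ hK z (by simpa using hz))
    (convex_closedBall 0 M) (by simpa using hy) (by simpa using hx)

/-- Divide the one-sided bound between `x + s • v` and `x` by `s ^ 2` and let `s` decrease to `0`.
-/
lemma inner_fderiv_le {L : ℝ} (hL : ∀ x y, inner ℝ (x - y) (b x - b y) ≤ L * ‖x - y‖ ^ 2)
    (hd : Differentiable ℝ b) (x v : EuclideanSpace ℝ (Fin d)) :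
    inner ℝ v (fderiv ℝ b x v) ≤ L * ‖v‖ ^ 2 := by
  have h1 : HasDerivAt (fun s : ℝ ↦ b (x + s • v)) (fderiv ℝ b x v) 0 := by
    have := ((hd x).hasFDerivAt (𝕜 := ℝ)).hasLineDerivAt v
    exact this
  have h2 := (hasDerivAt_iff_tendsto_slope_zero.1 h1).mono_left (nhdsGT_le_nhdsNE (0 : ℝ))
  have h3 := (tendsto_const_nhds (x := v)).inner (𝕜 := ℝ) h2
  refine le_of_tendsto h3 ?_
  filter_upwards [self_mem_nhdsWithin] with s (hs : 0 < s)
  have h4 := hL (x + s • v) x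
  simp only [zero_add, zero_smul, add_zero, add_sub_cancel_left] at h4 ⊢
  rw [inner_smul_left, norm_smul, mul_pow] at h4
  simp only [Real.norm_eq_abs, sq_abs, RCLike.conj_to_real] at h4
  rw [inner_smul_right, inv_mul_le_iff₀ hs]
  nlinarith

/-- The linearized flow along a continuous path is the value of a solution of the linear
equation. -/
lemma exists_isLinearizedFlow (hb : Continuous (fderiv ℝ b)) {y : ℝ≥0 → EuclideanSpace ℝ (Fin d)}
    (hy : Continuous y) (T : ℝ≥0) :
    ∃ Φ, IsLinearizedFlow b y T Φ := by
  -- Freezing the path after `T` makes the coefficients bounded on the whole line.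
  let A₀ : ℝ → EuclideanSpace ℝ (Fin d) →L[ℝ] EuclideanSpace ℝ (Fin d) :=
    fun t ↦ fderiv ℝ b (y (min t.toNNReal T))
  have hA₀ : Continuous A₀ := by fun_prop
  obtain ⟨K, hK⟩ : ∃ K : ℝ≥0, ∀ t, ‖A₀ t‖ ≤ K := by
    have hc : IsCompact ((fun s : ℝ≥0 ↦ fderiv ℝ b (y s)) '' Set.Icc 0 T) :=
      isCompact_Icc.image (by fun_prop)
    obtain ⟨C, hC⟩ := hc.isBounded.exists_norm_le
    refine ⟨C.toNNReal, fun t ↦ (hC _ ⟨min t.toNNReal T, ?_, rfl⟩).trans (Real.le_coe_toNNReal C)⟩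
    exact ⟨bot_le, min_le_right _ _⟩
  -- Left composition turns the operator equation into a linear equation in the space of operators.
  let 𝓛 := ContinuousLinearMap.compL ℝ (EuclideanSpace ℝ (Fin d)) (EuclideanSpace ℝ (Fin d))
    (EuclideanSpace ℝ (Fin d))
  obtain ⟨Φ, h0, h⟩ := exists_linear_ode (A := fun t ↦ 𝓛 (A₀ t)) (K := ‖𝓛‖₊ * K)
    (𝓛.continuous.comp hA₀) (fun t ↦ by
      push_cast
      exact (𝓛.le_opNorm _).trans (by gcongr; exact hK t)) T.2
    (ContinuousLinearMap.id ℝ _)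
  refine ⟨Φ, h0, fun t ht ↦ ?_⟩
  have hmin : min t.toNNReal T = t.toNNReal := by
    rw [min_eq_left]
    exact Real.toNNReal_le_iff_le_coe.2 ht.2
  have := h t ht
  simp only [A₀, hmin] at this
  exact this

/-- The later estimates hold for any solution, so uniqueness is never needed. -/
lemma exists_linearizedFlow_eq (hb : Continuous (fderiv ℝ b))
    {y : ℝ≥0 → EuclideanSpace ℝ (Fin d)} (hy : Continuous y) (T : ℝ≥0) :
    ∃ Φ, IsLinearizedFlow b y T Φ ∧ linearizedFlow b y T = Φ T := by
  have h := exists_isLinearizedFlow hb hy T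
  exact ⟨h.choose, h.choose_spec, by rw [linearizedFlow, dif_pos h]⟩

lemma HasDerivWithinAt.Ici_of_Icc {F : Type*} [NormedAddCommGroup F] [NormedSpace ℝ F]
    {f : ℝ → F} {f' : F} {a c t : ℝ} (h : HasDerivWithinAt f f' (Set.Icc a c) t)
    (ht : t ∈ Set.Ico a c) : HasDerivWithinAt f f' (Set.Ici t) t :=
  h.mono_of_mem_nhdsWithin (mem_of_superset (Icc_mem_nhdsGE ht.2)
    (Set.Icc_subset_Icc_left ht.1))

/-- Grönwall estimate for a nonnegative multiple of the square norm. -/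
lemma norm_sq_le_of_inner_le {F : Type*} [NormedAddCommGroup F] [InnerProductSpace ℝ F]
    {u u' : ℝ → F} {a c K ε : ℝ}
    (hu : ∀ t ∈ Set.Icc a c, HasDerivWithinAt u (u' t) (Set.Icc a c) t)
    (hle : ∀ t ∈ Set.Icc a c, 2 * inner ℝ (u t) (u' t) ≤ K * ‖u t‖ ^ 2 + ε) :
    ∀ t ∈ Set.Icc a c, ‖u t‖ ^ 2 ≤ gronwallBound (‖u a‖ ^ 2) K ε (t - a) := by
  have hd : ∀ t ∈ Set.Icc a c, HasDerivWithinAt (fun s ↦ ‖u s‖ ^ 2) (2 * inner ℝ (u t) (u' t))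
      (Set.Icc a c) t := fun t ht ↦ (hu t ht).norm_sq
  refine le_gronwallBound_of_liminf_deriv_right_le
    (f' := fun t ↦ 2 * inner ℝ (u t) (u' t))
    (fun t ht ↦ (hd t ht).continuousWithinAt) (fun t ht r hr ↦ ?_) le_rfl
    (fun t ht ↦ hle t (Set.Ico_subset_Icc_self ht))
  exact ((hd t (Set.Ico_subset_Icc_self ht)).Ici_of_Icc ht).liminf_right_slope_le hr

/-- Grönwall for `‖Φ t v‖ ^ 2`, whose derivative is at most `2 L ‖Φ t v‖ ^ 2`. The default value `0`
also obeys the bound, so no regularity of the path is required. -/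
lemma norm_linearizedFlow_apply_le {L : ℝ}
    (hL : ∀ x y, inner ℝ (x - y) (b x - b y) ≤ L * ‖x - y‖ ^ 2) (hd : Differentiable ℝ b)
    (y : ℝ≥0 → EuclideanSpace ℝ (Fin d)) (T : ℝ≥0) (v : EuclideanSpace ℝ (Fin d)) :
    ‖linearizedFlow b y T v‖ ≤ Real.exp (L * T) * ‖v‖ := by
  rw [linearizedFlow]
  split_ifs with h
  · obtain ⟨h0, h1⟩ := h.choose_spec
    set Φ := h.choose
    have h2 := norm_sq_le_of_inner_le (u := fun t ↦ Φ t v) (a := 0) (c := T) (K := 2 * L) (ε := 0)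
      (fun t ht ↦ (h1 t ht).clm_apply (hasDerivWithinAt_const t _ v)) (fun t ht ↦ by
        have := inner_fderiv_le hL hd (y t.toNNReal) (Φ t v)
        simp only [ContinuousLinearMap.comp_apply, map_zero, add_zero]
        linarith) T ⟨T.2, le_rfl⟩
    simp only [gronwallBound_ε0, h0, ContinuousLinearMap.id_apply, sub_zero] at h2
    refine le_of_sq_le_sq (h2.trans_eq ?_) (by positivity)
    rw [mul_pow, ← Real.exp_nat_mul]
    push_cast
    ring_nf
  · simp only [zero_apply, norm_zero]
    positivity

/-- Stability of the linearized flow: the coefficients may differ by a bounded amount on a short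
initial interval `[0, h]`, and have to be close on `[h, T]`. -/
lemma norm_sub_le_of_isLinearizedFlow {y z : ℝ≥0 → EuclideanSpace ℝ (Fin d)} {T h : ℝ≥0}
    (hT : h ≤ T) {Φ Ψ : ℝ → EuclideanSpace ℝ (Fin d) →L[ℝ] EuclideanSpace ℝ (Fin d)}
    (hΦ : IsLinearizedFlow b y T Φ) (hΨ : IsLinearizedFlow b z T Ψ) {K δ N : ℝ} (hK : 0 < K)
    (hδ : 0 ≤ δ) (hN : 0 ≤ N)
    (hy : ∀ s ≤ T, ‖fderiv ℝ b (y s)‖ ≤ K) (hz : ∀ s ≤ T, ‖fderiv ℝ b (z s)‖ ≤ K)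
    (hΨN : ∀ s ∈ Set.Icc (0 : ℝ) T, ‖Ψ s‖ ≤ N)
    (hyz : ∀ s, h ≤ s → s ≤ T → ‖fderiv ℝ b (y s) - fderiv ℝ b (z s)‖ ≤ δ) :
    ‖Φ T - Ψ T‖ ≤ 2 * N * (Real.exp (K * h) - 1) * Real.exp (K * T)
      + δ * N / K * Real.exp (K * T) := by
  have hd : ∀ t ∈ Set.Icc (0 : ℝ) T, HasDerivWithinAt (fun t ↦ Φ t - Ψ t)
      ((fderiv ℝ b (y t.toNNReal)).comp (Φ t - Ψ t) +
        (fderiv ℝ b (y t.toNNReal) - fderiv ℝ b (z t.toNNReal)).comp (Ψ t))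
      (Set.Icc (0 : ℝ) T) t := by
    intro t ht
    refine ((hΦ.2 t ht).fun_sub (hΨ.2 t ht)).congr_deriv ?_
    ext1 v
    simp
  have hbd : ∀ t ∈ Set.Icc (0 : ℝ) T, ∀ ε,
      ‖fderiv ℝ b (y t.toNNReal) - fderiv ℝ b (z t.toNNReal)‖ ≤ ε →
      ‖(fderiv ℝ b (y t.toNNReal)).comp (Φ t - Ψ t) +
        (fderiv ℝ b (y t.toNNReal) - fderiv ℝ b (z t.toNNReal)).comp (Ψ t)‖
        ≤ K * ‖Φ t - Ψ t‖ + ε * N := by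
    intro t ht ε hε
    refine (norm_add_le _ _).trans (add_le_add ?_ ?_)
    · refine (ContinuousLinearMap.opNorm_comp_le _ _).trans ?_
      gcongr
      exact hy _ (Real.toNNReal_le_iff_le_coe.2 ht.2)
    · refine (ContinuousLinearMap.opNorm_comp_le _ _).trans ?_
      gcongr
      · exact (norm_nonneg _).trans hε
      · exact hΨN t ht
  have hhT : (h : ℝ) ≤ T := by exact_mod_cast hT
  have hc : ContinuousOn (fun t ↦ Φ t - Ψ t) (Set.Icc (0 : ℝ) T) :=
    fun t ht ↦ (hd t ht).continuousWithinAt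
  -- On `[0, h]` the coefficients differ by at most `2 K`; the resulting error is the initial datum
  -- for a second Grönwall estimate on `[h, T]`.
  have h1 := norm_le_gronwallBound_of_norm_deriv_right_le (a := 0) (b := h) (δ := 0) (K := K)
    (ε := 2 * K * N) (hc.mono (Set.Icc_subset_Icc_right hhT))
    (fun t ht ↦ (hd t ⟨ht.1, ht.2.le.trans hhT⟩).Ici_of_Icc ⟨ht.1, ht.2.trans_le hhT⟩)
    (by rw [hΦ.1, hΨ.1]; simp)
    (fun t ht ↦ hbd t ⟨ht.1, ht.2.le.trans hhT⟩ (2 * K) (by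
      have ht' : t.toNNReal ≤ T := Real.toNNReal_le_iff_le_coe.2 (ht.2.le.trans hhT)
      exact (norm_sub_le _ _).trans (by linarith [hy _ ht', hz _ ht'])))
    h ⟨h.2, le_rfl⟩
  have h2 := norm_le_gronwallBound_of_norm_deriv_right_le (a := h) (b := T)
    (δ := gronwallBound 0 K (2 * K * N) (h - 0)) (K := K)
    (ε := δ * N) (hc.mono (Set.Icc_subset_Icc_left h.2))
    (fun t ht ↦ (hd t ⟨h.2.trans ht.1, ht.2.le⟩).Ici_of_Icc ⟨h.2.trans ht.1, ht.2⟩)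
    h1
    (fun t ht ↦ hbd t ⟨h.2.trans ht.1, ht.2.le⟩ δ
      (hyz _ (NNReal.le_toNNReal_of_coe_le ht.1) (Real.toNNReal_le_iff_le_coe.2 ht.2.le)))
    T ⟨hhT, le_rfl⟩
  refine h2.trans ?_
  have hE : Real.exp (K * (T - h)) ≤ Real.exp (K * T) := by
    apply Real.exp_le_exp.2
    have : 0 ≤ K * h := by positivity
    nlinarith
  have hE1 : 0 ≤ Real.exp (K * h) - 1 := by
    have : 0 ≤ K * h := by positivity
    linarith [Real.add_one_le_exp (K * h)]
  simp only [gronwallBound_of_K_ne_0 hK.ne', zero_mul, zero_add, sub_zero]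
  have h3 : 2 * K * N / K = 2 * N := by field_simp
  rw [h3]
  gcongr
  linarith

end Flow

/-! ### Pathwise stability under perturbation of the noise. -/

section Tube

variable {d : ℕ} {b : EuclideanSpace ℝ (Fin d) → EuclideanSpace ℝ (Fin d)}

/-- Two solutions of an additively driven, one-sided Lipschitz equation stay close if their initial
conditions and driving paths are close. -/
lemma norm_sub_le_of_integral_equation {L : ℝ} (hL0 : 0 < L)
    (hL : ∀ x y, inner ℝ (x - y) (b x - b y) ≤ L * ‖x - y‖ ^ 2) (hb : Continuous b)
    {x g w c : ℝ → EuclideanSpace ℝ (Fin d)} {x₀ g₀ : EuclideanSpace ℝ (Fin d)} {K δ T : ℝ}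
    (hxc : Continuous x) (hgc : Continuous g) (hK0 : 0 ≤ K) (hδ : 0 ≤ δ)
    (hx : ∀ t ∈ Set.Icc 0 T, x t = x₀ + (∫ s in (0 : ℝ)..t, b (x s)) + w t)
    (hg : ∀ t ∈ Set.Icc 0 T, g t = g₀ + (∫ s in (0 : ℝ)..t, b (g s)) + c t)
    (hK : ∀ t ∈ Set.Icc 0 T, ∀ r, ‖r‖ ≤ 2 * δ → ‖b (g t + r) - b (g t)‖ ≤ K * ‖r‖)
    (h0 : ‖x₀ - g₀‖ ≤ δ) (hwc : ∀ t ∈ Set.Icc 0 T, ‖w t - c t‖ ≤ δ) :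
    ∀ t ∈ Set.Icc 0 T, ‖x t - g t‖ ≤ 2 * δ * (1 + K * Real.exp ((2 * L + 1) * T)) := by
  -- `x - g` need not be differentiable. Its drift part `u` is, and the remainder `r` (initial and
  -- noise errors) is at most `2 δ`. The one-sided bound is used between `x` and `g + r`, whose
  -- difference is `u`.
  set u : ℝ → EuclideanSpace ℝ (Fin d) := fun t ↦ ∫ s in (0 : ℝ)..t, (b (x s) - b (g s)) with hu
  have hcx : Continuous fun s ↦ b (x s) := hb.comp hxc
  have hcg : Continuous fun s ↦ b (g s) := hb.comp hgc
  have hd : ∀ t, HasDerivAt u (b (x t) - b (g t)) t := fun t ↦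
    (hcx.sub hcg).integral_hasStrictDerivAt 0 t |>.hasDerivAt
  have hut : ∀ t ∈ Set.Icc 0 T, x t = g t + (x₀ - g₀ + (w t - c t)) + u t := by
    intro t ht
    rw [hx t ht, hg t ht, hu]
    simp only
    rw [intervalIntegral.integral_sub (hcx.intervalIntegrable _ _) (hcg.intervalIntegrable _ _)]
    abel
  have hr : ∀ t ∈ Set.Icc 0 T, ‖x₀ - g₀ + (w t - c t)‖ ≤ 2 * δ := fun t ht ↦
    (norm_add_le _ _).trans (by linarith [hwc t ht])
  have hgr := norm_sq_le_of_inner_le (u := u) (a := 0) (c := T) (K := 2 * L + 1)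
    (ε := (2 * K * δ) ^ 2) (fun t _ ↦ (hd t).hasDerivWithinAt) (fun t ht ↦ by
      set r := x₀ - g₀ + (w t - c t) with hrdef
      have h1 := hL (x t) (g t + r)
      have h2 : x t - (g t + r) = u t := by rw [hut t ht, hrdef]; abel
      rw [h2] at h1
      have h3 : inner ℝ (u t) (b (g t + r) - b (g t)) ≤ ‖u t‖ * (2 * K * δ) := by
        refine (real_inner_le_norm _ _).trans ?_
        gcongr
        refine (hK t ht r (hr t ht)).trans ?_
        calc K * ‖r‖ ≤ K * (2 * δ) := by gcongr; exact hr t ht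
          _ = 2 * K * δ := by ring
      have h4 : b (x t) - b (g t) = (b (x t) - b (g t + r)) + (b (g t + r) - b (g t)) := by abel
      rw [h4, inner_add_right]
      nlinarith [sq_nonneg (‖u t‖ - 2 * K * δ)])
  intro t ht
  have hT : 0 ≤ T := ht.1.trans ht.2
  have h1 : ‖u t‖ ≤ 2 * K * δ * Real.exp ((2 * L + 1) * T) := by
    refine le_of_sq_le_sq ((hgr t ht).trans ?_) (by positivity)
    have hu0 : u 0 = 0 := by simp [hu]
    have hA : (1 : ℝ) ≤ 2 * L + 1 := by linarith
    have hE : Real.exp ((2 * L + 1) * t) ≤ Real.exp ((2 * L + 1) * T) := by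
      gcongr; exact ht.2
    have hE1 : 1 ≤ Real.exp ((2 * L + 1) * T) := Real.one_le_exp (by positivity)
    rw [hu0, gronwallBound_of_K_ne_0 (by positivity)]
    simp only [norm_zero, ne_eq, OfNat.ofNat_ne_zero, not_false_eq_true, zero_pow, zero_mul,
      zero_add, sub_zero]
    calc (2 * K * δ) ^ 2 / (2 * L + 1) * (Real.exp ((2 * L + 1) * t) - 1)
        ≤ (2 * K * δ) ^ 2 * Real.exp ((2 * L + 1) * T) ^ 2 := by
          gcongr
          · have : 1 ≤ Real.exp ((2 * L + 1) * t) :=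
              Real.one_le_exp (mul_nonneg (by linarith) ht.1)
            linarith
          · exact div_le_self (by positivity) hA
          · nlinarith
      _ = _ := by ring
  have h2 : x t - g t = (x₀ - g₀ + (w t - c t)) + u t := by rw [hut t ht]; abel
  rw [h2]
  refine (norm_add_le _ _).trans ?_
  linarith [hr t ht]

/-- Lets path events be written with countably many times, hence measurably; truncating at `T` keeps
them dependent on times up to `T` only. -/
lemma forall_le_of_forall_denseSeq {f : ℝ≥0 → ℝ} (hf : Continuous f) {T : ℝ≥0} {a : ℝ}
    (h : ∀ n, f (min (TopologicalSpace.denseSeq ℝ≥0 n) T) ≤ a) : ∀ t ≤ T, f t ≤ a := by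
  intro t ht
  have hcl : IsClosed {t | f (min t T) ≤ a} := isClosed_le (by fun_prop) continuous_const
  have := (TopologicalSpace.denseRange_denseSeq ℝ≥0).induction_on (p := fun t ↦ f (min t T) ≤ a)
    t hcl h
  rwa [min_eq_left ht] at this

end Tube

/-! ### Transferring admissibility through the noise. -/

section Brownian

variable {Ω : Type*} {mΩ : MeasurableSpace Ω} {P : Measure Ω} {d : ℕ} {ℱ : Filtration ℝ≥0 mΩ}
  {B : ℝ≥0 → Ω → EuclideanSpace ℝ (Fin d)}

/-- The finite-dimensional laws are prescribed, and they determine the law on path space. -/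
lemma ProbabilityTheory.IsPreBrownianReal.identDistrib [IsProbabilityMeasure P]
    {Y Z : ℝ≥0 → Ω → ℝ} (hY : IsPreBrownianReal Y P) (hZ : IsPreBrownianReal Z P)
    (hYm : AEMeasurable (fun ω t ↦ Y t ω) P) (hZm : AEMeasurable (fun ω t ↦ Z t ω) P) :
    IdentDistrib (fun ω t ↦ Y t ω) (fun ω t ↦ Z t ω) P P :=
  ⟨hYm, hZm, (map_eq_iff_forall_finset_map_restrict_eq hYm hZm).2
    fun I ↦ (hY.hasLaw I).map_eq.trans (hZ.hasLaw I).map_eq.symm⟩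

namespace IsFilteredBrownianMotion

lemma measurable (hB : IsFilteredBrownianMotion ℱ B P) (t : ℝ≥0) : Measurable (B t) :=
  (hB.adapted t).mono (ℱ.le t) le_rfl

lemma ae_continuous (hB : IsFilteredBrownianMotion ℱ B P) :
    ∀ᵐ ω ∂P, Continuous (fun t ↦ B t ω) := by
  filter_upwards [ae_all_iff.2 fun i ↦ (hB.isBrownian i).cont] with ω hω
  exact (PiLp.continuous_toLp 2 _).comp (continuous_pi hω)

/-- Stationarity of the increments. -/
lemma identDistrib_shift [IsProbabilityMeasure P] (hB : IsFilteredBrownianMotion ℱ B P)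
    (s : ℝ≥0) :
    IdentDistrib (fun ω (t : ℝ≥0) ↦ B (s + t) ω - B s ω) (fun ω t ↦ B t ω) P P := by
  have hm := hB.measurable
  have hcoord (i : Fin d) : IdentDistrib (fun ω (t : ℝ≥0) ↦ B (s + t) ω i - B s ω i)
      (fun ω t ↦ B t ω i) P P :=
    ((hB.isBrownian i).toIsPreBrownianReal.shift s).identDistrib
      (hB.isBrownian i).toIsPreBrownianReal (Measurable.aemeasurable (by fun_prop))
      (Measurable.aemeasurable (by fun_prop))
  have hind : iIndepFun (fun (i : Fin d) ω (t : ℝ≥0) ↦ B (s + t) ω i - B s ω i) P :=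
    hB.indep_coord.comp (fun _ w t ↦ w (s + t) - w s) (fun _ ↦ by fun_prop)
  have := (IdentDistrib.pi hcoord hind hB.indep_coord).comp
    (u := fun f (t : ℝ≥0) ↦ WithLp.toLp 2 (fun i ↦ f i t)) (by fun_prop)
  exact this

end IsFilteredBrownianMotion

variable {b : EuclideanSpace ℝ (Fin d) → EuclideanSpace ℝ (Fin d)} {σ : Matrix (Fin d) (Fin d) ℝ}
  {X : EuclideanSpace ℝ (Fin d) → ℝ≥0 → Ω → EuclideanSpace ℝ (Fin d)}

/-- If `γ` is admissible, then the noise stays close to the driving path of `γ` with positive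
probability. -/
lemma measure_noise_close_pos (hb : BasicConditions b)
    (hX : ∀ x, IsSDESolution b σ ℱ B P x (X x)) {γ : ℝ≥0 → EuclideanSpace ℝ (Fin d)}
    (hγ : Continuous γ) {T : ℝ≥0} (hγT : γ ∈ admissiblePaths P X T) {δ : ℝ} (hδ : 0 < δ) :
    0 < P {ω | ∀ t ≤ T, ‖Matrix.toEuclideanCLM (n := Fin d) (𝕜 := ℝ) σ (B t ω)
      - (γ t - γ 0 - ∫ s in (0 : ℝ)..t, b (γ s.toNNReal))‖ ≤ δ} := by
  obtain ⟨M, hM⟩ := (isCompact_Icc (a := (0 : ℝ≥0)) (b := T)).image hγ |>.isBounded.exists_norm_le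
  obtain ⟨K, hK0, hK⟩ := hb.exists_norm_sub_le (M + 1)
  have hTK : 0 < 1 + K * (T : ℝ) := by positivity
  -- The noise error is the position error plus an integral of drift differences, at most `ε (1 + K
  -- T)`; `ε ≤ 1` keeps `X` in the ball where `K` is a Lipschitz constant.
  set ε := min 1 (δ / (1 + K * T)) with hε
  have hε0 : 0 < ε := lt_min one_pos (by positivity)
  have hε2 : ε * (1 + K * T) ≤ δ := (le_div_iff₀ hTK).1 (min_le_right _ _)
  refine (hγT.2 ε hε0).trans_le (measure_mono_ae ?_)
  filter_upwards [(hX (γ 0)).continuous_paths, (hX (γ 0)).equation] with ω hc heq hω t ht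
  change ∀ t ≤ T, ‖X (γ 0) t ω - γ t‖ ≤ ε at hω
  have hcX : Continuous fun s : ℝ ↦ b (X (γ 0) s.toNNReal ω) :=
    hb.contDiff.continuous.comp (hc.comp continuous_real_toNNReal)
  have hcγ : Continuous fun s : ℝ ↦ b (γ s.toNNReal) :=
    hb.contDiff.continuous.comp (hγ.comp continuous_real_toNNReal)
  have h1 : Matrix.toEuclideanCLM (n := Fin d) (𝕜 := ℝ) σ (B t ω)
      - (γ t - γ 0 - ∫ s in (0 : ℝ)..t, b (γ s.toNNReal))
      = (X (γ 0) t ω - γ t)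
        - ∫ s in (0 : ℝ)..t, (b (X (γ 0) s.toNNReal ω) - b (γ s.toNNReal)) := by
    rw [intervalIntegral.integral_sub (hcX.intervalIntegrable _ _) (hcγ.intervalIntegrable _ _),
      heq t]
    abel
  have h2 : ‖∫ s in (0 : ℝ)..t, (b (X (γ 0) s.toNNReal ω) - b (γ s.toNNReal))‖
      ≤ K * ε * |(t : ℝ) - 0| := by
    refine intervalIntegral.norm_integral_le_of_norm_le_const fun s hs ↦ ?_
    rw [Set.uIoc_of_le t.coe_nonneg] at hs
    have hsT : s.toNNReal ≤ T := (Real.toNNReal_le_iff_le_coe.2 hs.2).trans ht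
    have hγs : ‖γ s.toNNReal‖ ≤ M := hM _ ⟨_, ⟨bot_le, hsT⟩, rfl⟩
    have hXs := hω _ hsT
    have := norm_le_norm_add_norm_sub' (X (γ 0) s.toNNReal ω) (γ s.toNNReal)
    refine (hK _ _ (by linarith [min_le_left 1 (δ / (1 + K * T))]) (by linarith)).trans ?_
    gcongr
  rw [h1]
  refine (norm_sub_le _ _).trans ?_
  rw [sub_zero, abs_of_nonneg t.coe_nonneg] at h2
  have h3 : K * ε * t ≤ K * ε * T := by gcongr
  linarith [hω t ht]

/-- The Markov property in the form needed here: after having been steered close to `γ 0` at time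
`h`, the process follows `γ` with positive probability. -/
lemma exists_measurableSet_follow [IsProbabilityMeasure P] (hB : IsFilteredBrownianMotion ℱ B P)
    (hb : BasicConditions b)
    (hX : ∀ x, IsSDESolution b σ ℱ B P x (X x)) {γ : ℝ≥0 → EuclideanSpace ℝ (Fin d)}
    (hγ : Continuous γ) {T : ℝ≥0} (hγT : γ ∈ admissiblePaths P X T)
    {x : EuclideanSpace ℝ (Fin d)} {h : ℝ≥0} {K : ℝ}
    (hK : ∀ ε : ℝ, 0 < ε →
      0 < P {ω | ‖X x h ω - γ 0‖ ≤ ε ∧ ∀ s ≤ h, ‖fderiv ℝ b (X x s ω)‖ ≤ K})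
    {ε : ℝ} (hε : 0 < ε) :
    ∃ A, MeasurableSet A ∧ 0 < P A ∧ ∀ᵐ ω ∂P, ω ∈ A →
      (∀ s ≤ h, ‖fderiv ℝ b (X x s ω)‖ ≤ K) ∧ ∀ t ≤ T, ‖X x (h + t) ω - γ t‖ ≤ ε := by
  obtain ⟨L, hL0, hL⟩ := hb.one_sided_lipschitz
  obtain ⟨M, hM⟩ := (isCompact_Icc (a := (0 : ℝ≥0)) (b := T)).image hγ |>.isBounded.exists_norm_le
  -- Radius `M + 2`: the perturbation of `γ` has size at most `2 δ ≤ 2`.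
  obtain ⟨K', hK'0, hK'⟩ := hb.exists_norm_sub_le (M + 2)
  set S := Matrix.toEuclideanCLM (n := Fin d) (𝕜 := ℝ) σ with hS
  set c : ℝ≥0 → EuclideanSpace ℝ (Fin d) :=
    fun t ↦ γ t - γ 0 - ∫ s in (0 : ℝ)..t, b (γ s.toNNReal) with hc
  set q := TopologicalSpace.denseSeq ℝ≥0
  set D := 2 * (1 + K' * Real.exp ((2 * L + 1) * T)) with hD
  have hD0 : 0 < D := by positivity
  set δ := min 1 (ε / D) with hδ
  have hδ0 : 0 < δ := lt_min one_pos (by positivity)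
  have hδ1 : δ ≤ 1 := min_le_left _ _
  have hδε : δ * D ≤ ε := (le_div_iff₀ hD0).1 (min_le_right _ _)
  have hcγ : Continuous fun s : ℝ ↦ b (γ s.toNNReal) :=
    hb.contDiff.continuous.comp (hγ.comp continuous_real_toNNReal)
  have hcc : Continuous c := by
    have : Continuous fun t : ℝ ↦ ∫ s in (0 : ℝ)..t, b (γ s.toNNReal) :=
      intervalIntegral.continuous_primitive (fun a c ↦ hcγ.intervalIntegrable a c) 0
    fun_prop
  -- the noise event
  set F : Set (ℝ≥0 → EuclideanSpace ℝ (Fin d)) :=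
    ⋂ n, {w | ‖S (w (min (q n) T)) - c (min (q n) T)‖ ≤ δ} with hF
  have hFm : MeasurableSet F := MeasurableSet.iInter fun n ↦
    measurableSet_le (by fun_prop) measurable_const
  set Z : Ω → ℝ≥0 → EuclideanSpace ℝ (Fin d) := fun ω t ↦ B (h + t) ω - B h ω with hZ
  have hFpos : 0 < P (Z ⁻¹' F) := by
    have h1 : P (Z ⁻¹' F) = P ((fun ω t ↦ B t ω) ⁻¹' F) :=
      (hB.identDistrib_shift h).measure_mem_eq hFm
    rw [h1]
    refine (measure_noise_close_pos hb hX hγ hγT hδ0).trans_le (measure_mono fun ω hω ↦ ?_)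
    exact Set.mem_iInter.2 fun n ↦ hω _ (min_le_right _ _)
  -- the steering event
  set E : Set Ω := {ω | ‖X x h ω - γ 0‖ ≤ δ} ∩
    ⋂ n, {ω | ‖fderiv ℝ b (X x (min (q n) h) ω)‖ ≤ K} with hE
  have hEm : MeasurableSet[ℱ h] E := by
    refine MeasurableSet.inter ?_ (MeasurableSet.iInter fun n ↦ ?_)
    · exact (hX x).adapted h (measurableSet_le (f := fun z ↦ ‖z - γ 0‖) (by fun_prop) measurable_const)
    · have h1 : Measurable[ℱ h] (X x (min (q n) h)) :=
        ((hX x).adapted _).mono (ℱ.mono (min_le_right _ _)) le_rfl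
      exact h1 (measurableSet_le (f := fun z ↦ ‖fderiv ℝ b z‖) hb.continuous_fderiv.norm.measurable measurable_const)
  have hEpos : 0 < P E := by
    refine (hK δ hδ0).trans_le (measure_mono fun ω hω ↦ ⟨hω.1, ?_⟩)
    exact Set.mem_iInter.2 fun n ↦ hω.2 _ (min_le_right _ _)
  -- The increments after `h` are independent of `ℱ h`, which contains `E`.
  have hpos : 0 < P (Z ⁻¹' F ∩ E) := by
    rw [(Indep_iff _ _ _).1 (hB.indep_increments h) (Z ⁻¹' F) E ⟨F, hFm, rfl⟩ hEm]
    exact ENNReal.mul_pos hFpos.ne' hEpos.ne'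
  have hZm : Measurable Z := by
    have := hB.measurable
    fun_prop
  refine ⟨_, (hZm hFm).inter (ℱ.le h _ hEm), hpos, ?_⟩
  filter_upwards [(hX x).continuous_paths, (hX x).equation, hB.ae_continuous]
    with ω hXc heq hBc hω
  obtain ⟨hωF, hωE⟩ := hω
  have h1 : ∀ s ≤ h, ‖fderiv ℝ b (X x s ω)‖ ≤ K :=
    forall_le_of_forall_denseSeq (hb.continuous_fderiv.comp hXc).norm fun n ↦ Set.mem_iInter.1 hωE.2 n
  have h2 : ∀ t ≤ T, ‖S (Z ω t) - c t‖ ≤ δ :=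
    forall_le_of_forall_denseSeq (by fun_prop) fun n ↦ Set.mem_iInter.1 hωF n
  refine ⟨h1, fun t ht ↦ ?_⟩
  have hcX : Continuous fun s : ℝ ↦ b (X x s.toNNReal ω) :=
    hb.contDiff.continuous.comp (hXc.comp continuous_real_toNNReal)
  -- The shifted process solves the same equation from `X x h` with noise `S (Z ω)`, and `γ` solves
  -- it with driving path `c`.
  have hmain := norm_sub_le_of_integral_equation (b := b) hL0 hL hb.contDiff.continuous
    (x := fun s ↦ X x (h + s.toNNReal) ω) (g := fun s ↦ γ s.toNNReal)
    (w := fun s ↦ S (Z ω s.toNNReal)) (c := fun s ↦ c s.toNNReal)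
    (x₀ := X x h ω) (g₀ := γ 0) (K := K') (δ := δ) (T := T)
    (by fun_prop) (by fun_prop) hK'0.le hδ0.le
    (fun s hs ↦ ?_) (fun s hs ↦ ?_) (fun s hs r hr ↦ ?_) hωE.1 (fun s hs ↦ ?_)
    t ⟨t.2, by exact_mod_cast ht⟩
  · simp only [Real.toNNReal_coe] at hmain
    refine hmain.trans (le_trans (le_of_eq ?_) hδε)
    rw [hD]; ring
  · have hs0 : ((s.toNNReal : ℝ≥0) : ℝ) = s := Real.coe_toNNReal _ hs.1
    have h3 : ∫ r in (0 : ℝ)..s, b (X x (h + r.toNNReal) ω)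
        = ∫ r in (h : ℝ)..(h + s), b (X x r.toNNReal ω) := by
      have := intervalIntegral.integral_comp_add_left (a := 0) (b := s)
        (fun r ↦ b (X x r.toNNReal ω)) (h : ℝ)
      rw [add_zero] at this
      rw [← this]
      refine intervalIntegral.integral_congr fun r hr ↦ ?_
      rw [Set.uIcc_of_le hs.1] at hr
      simp only [Real.toNNReal_add h.coe_nonneg hr.1, Real.toNNReal_coe]
    have h4 := intervalIntegral.integral_add_adjacent_intervals
      (hcX.intervalIntegrable (μ := volume) 0 h) (hcX.intervalIntegrable (μ := volume) h (h + s))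
    have h5 := heq (h + s.toNNReal)
    have h6 := heq h
    rw [NNReal.coe_add, hs0, ← h4] at h5
    change X x (h + s.toNNReal) ω = _ + _ + S (B (h + s.toNNReal) ω - B h ω)
    rw [map_sub, h3, h5, h6]
    abel
  · change γ s.toNNReal = γ 0 + _ +
      (γ s.toNNReal - γ 0 - ∫ r in (0 : ℝ)..s.toNNReal, b (γ r.toNNReal))
    rw [Real.coe_toNNReal _ hs.1]
    abel
  · have hγs : ‖γ s.toNNReal‖ ≤ M :=
      hM _ ⟨_, ⟨bot_le, Real.toNNReal_le_iff_le_coe.2 hs.2⟩, rfl⟩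
    have := hK' (γ s.toNNReal + r) (γ s.toNNReal)
      ((norm_add_le _ _).trans (by linarith)) (by linarith)
    rwa [add_sub_cancel_left] at this
  · exact h2 _ (Real.toNNReal_le_iff_le_coe.2 hs.2)

end Brownian

/-! ### Moment norms as the exponent tends to infinity. -/

section Moments

variable {α : Type*} {m : MeasurableSpace α} {μ : Measure α} [IsProbabilityMeasure μ]

/-- Monotonicity in `p` of the `p`-th moment norm, without measurability assumption. -/
lemma lintegral_rpow_le_of_exponent_le (f : α → ℝ≥0∞) {p q : ℝ} (hp : 0 < p) (hpq : p ≤ q) :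
    (∫⁻ a, f a ^ p ∂μ) ^ (1 / p) ≤ (∫⁻ a, f a ^ q ∂μ) ^ (1 / q) := by
  -- A measurable minorant of `f ^ p` with the same integral reduces to the measurable case.
  obtain ⟨g, hg, hgf, hfg⟩ := exists_measurable_le_lintegral_eq μ (fun a ↦ f a ^ p)
  have hq : 0 < q := hp.trans_le hpq
  have h1 : ∀ a, g a ^ (1 / p) ≤ f a := fun a ↦ by
    rw [one_div]; exact (ENNReal.rpow_inv_le_iff hp).2 (hgf a)
  have h2 := eLpNorm'_le_eLpNorm'_of_exponent_le hp hpq μ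
    (f := fun a ↦ g a ^ (1 / p)) (hg.pow_const _).aestronglyMeasurable
  simp only [eLpNorm', enorm_eq_self] at h2
  rw [hfg]
  calc (∫⁻ a, g a ∂μ) ^ (1 / p) = (∫⁻ a, (g a ^ (1 / p)) ^ p ∂μ) ^ (1 / p) := by
        congr 2; ext a; rw [one_div, ENNReal.rpow_inv_rpow hp.ne']
    _ ≤ _ := h2
    _ ≤ _ := by gcongr with a; exact h1 a

lemma lintegral_rpow_le_of_forall_le {f : α → ℝ≥0∞} {C : ℝ≥0∞} (hf : ∀ a, f a ≤ C) {p : ℝ}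
    (hp : 0 < p) : (∫⁻ a, f a ^ p ∂μ) ^ (1 / p) ≤ C := by
  rw [one_div, ENNReal.rpow_inv_le_iff hp]
  calc ∫⁻ a, f a ^ p ∂μ ≤ ∫⁻ _, C ^ p ∂μ := by gcongr with a; exact hf a
    _ = C ^ p := by simp

/-- A lower bound on a set of positive probability passes to the limit of the `p`-th moment
norms. -/
lemma le_of_tendsto_lintegral_rpow {f : α → ℝ≥0∞} {u : ℝ → ℝ≥0∞} {l c : ℝ≥0∞} (hc : c ≠ ∞)
    (hu : Tendsto u atTop (𝓝 l)) (hfu : ∀ p, 0 < p → (∫⁻ a, f a ^ p ∂μ) ^ (1 / p) ≤ u p)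
    {A : Set α} (hA : MeasurableSet A) (hA0 : 0 < μ A) (hf : ∀ᵐ a ∂μ, a ∈ A → c ≤ f a) :
    c ≤ l := by
  -- The moment norm is at least `c * μ A ^ (1 / p)`, and the second factor tends to `1` as `μ A >
  -- 0`.
  have hlim : Tendsto (fun p : ℝ ↦ c * μ A ^ (1 / p)) atTop (𝓝 c) := by
    have hr : 0 < μ.real A := ENNReal.toReal_pos hA0.ne' (measure_ne_top _ _)
    have h1 : Tendsto (fun p : ℝ ↦ (μ.real A) ^ (1 / p)) atTop (𝓝 1) := by
      have := (Real.continuousAt_const_rpow (b := 0) hr.ne').tendsto.comp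
        (tendsto_const_nhds.div_atTop tendsto_id : Tendsto (fun p : ℝ ↦ 1 / p) atTop (𝓝 0))
      rwa [Real.rpow_zero] at this
    have h2 := ENNReal.tendsto_ofReal h1
    have h3 : (fun p : ℝ ↦ μ A ^ (1 / p)) = fun p ↦ ENNReal.ofReal (μ.real A ^ (1 / p)) := by
      ext p
      rw [← ENNReal.ofReal_rpow_of_pos hr, ofReal_measureReal]
    rw [← h3, ENNReal.ofReal_one] at h2
    simpa using ENNReal.Tendsto.const_mul h2 (Or.inr hc)
  refine le_of_tendsto_of_tendsto hlim hu ?_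
  filter_upwards [eventually_gt_atTop 0] with p hp
  refine le_trans ?_ (hfu p hp)
  have h1 : c ^ p * μ A ≤ ∫⁻ a, f a ^ p ∂μ := by
    rw [← lintegral_indicator_const hA]
    refine lintegral_mono_ae ?_
    filter_upwards [hf] with a ha
    by_cases h : a ∈ A
    · rw [Set.indicator_of_mem h]
      exact ENNReal.rpow_le_rpow (ha h) hp.le
    · simp [Set.indicator_of_notMem h]
  calc c * μ A ^ (1 / p) = (c ^ p * μ A) ^ (1 / p) := by
        rw [ENNReal.mul_rpow_of_nonneg _ _ (by positivity), one_div, ENNReal.rpow_rpow_inv hp.ne']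
    _ ≤ _ := by gcongr

/-- A bounded function that is monotone on the positive half-line has a finite limit at
infinity. -/
lemma exists_tendsto_of_monotone_of_le {u : ℝ → ℝ≥0∞} {C : ℝ≥0∞} (hC : C ≠ ∞)
    (hu : ∀ p q, 0 < p → p ≤ q → u p ≤ u q) (huC : ∀ p, 0 < p → u p ≤ C) :
    ∃ l, l ≠ ∞ ∧ Tendsto u atTop (𝓝 l) := by
  have hm : Monotone fun p ↦ u (max p 1) := fun p q hpq ↦
    hu _ _ (lt_max_of_lt_right one_pos) (max_le_max_right 1 hpq)
  refine ⟨⨆ p, u (max p 1), ne_top_of_le_ne_top hC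
    (iSup_le fun p ↦ huC _ (lt_max_of_lt_right one_pos)), ?_⟩
  refine (tendsto_atTop_iSup hm).congr' ?_
  filter_upwards [eventually_ge_atTop 1] with p hp
  rw [max_eq_left hp]

end Moments

/-! ### Steering, following, and the lower bound. -/

section Main

variable {Ω : Type*} {mΩ : MeasurableSpace Ω} {P : Measure Ω} {d : ℕ}
  {b : EuclideanSpace ℝ (Fin d) → EuclideanSpace ℝ (Fin d)} {σ : Matrix (Fin d) (Fin d) ℝ}
  {ℱ : Filtration ℝ≥0 mΩ} {B : ℝ≥0 → Ω → EuclideanSpace ℝ (Fin d)}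
  {X : EuclideanSpace ℝ (Fin d) → ℝ≥0 → Ω → EuclideanSpace ℝ (Fin d)}

lemma linearizedFlow_congr {y z : ℝ≥0 → EuclideanSpace ℝ (Fin d)} {T : ℝ≥0}
    (h : ∀ t ≤ T, y t = z t) : linearizedFlow b y T = linearizedFlow b z T := by
  have : IsLinearizedFlow b y T = IsLinearizedFlow b z T := by
    ext Φ
    refine and_congr_right fun _ ↦ forall₂_congr fun t ht ↦ ?_
    rw [h _ (Real.toNNReal_le_iff_le_coe.2 ht.2)]
  unfold linearizedFlow
  rw [this]

/-- In both cases of the alternative on the drift, the process can be steered to any point in a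
short time while keeping the coefficients of the linearized equation bounded. -/
lemma exists_steering_bound (hb : BasicConditions b) (hcontrol : IsControllable P X)
    (hcond : (∃ M : ℝ, ∀ x, ‖fderiv ℝ b x‖ ≤ M) ∨ IsControllableInTubes P X)
    (x y : EuclideanSpace ℝ (Fin d)) :
    ∃ K : ℝ, ∀ h : ℝ≥0, 0 < h → ∀ ε : ℝ, 0 < ε →
      0 < P {ω | ‖X x h ω - y‖ ≤ ε ∧ ∀ s ≤ h, ‖fderiv ℝ b (X x s ω)‖ ≤ K} := by
  rcases hcond with ⟨M, hM⟩ | htube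
  · exact ⟨M, fun h hh ε hε ↦ (hcontrol x y h hh ε hε).trans_le
      (measure_mono fun ω hω ↦ ⟨hω, fun s _ ↦ hM _⟩)⟩
  · obtain ⟨R, -, hR⟩ := htube x y
    obtain ⟨K, -, hK⟩ := hb.exists_norm_fderiv_le R
    exact ⟨K, fun h hh ε hε ↦ (hR h hh ε hε).trans_le
      (measure_mono fun ω hω ↦ ⟨hω.1, fun s hs ↦ hK _ (hω.2 s hs)⟩)⟩

/-- From any starting point, the linearized flow is close to the one along a given admissible path
with positive probability. -/
lemma exists_measurableSet_linearizedFlow_close [IsProbabilityMeasure P]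
    (hB : IsFilteredBrownianMotion ℱ B P) (hX : ∀ x, IsSDESolution b σ ℱ B P x (X x))
    (hb : BasicConditions b) (hcontrol : IsControllable P X)
    (hcond : (∃ M : ℝ, ∀ x, ‖fderiv ℝ b x‖ ≤ M) ∨ IsControllableInTubes P X)
    {T : ℝ≥0} {γ : ℝ≥0 → EuclideanSpace ℝ (Fin d)} (hγ : Continuous γ)
    (hγT : γ ∈ admissiblePaths P X T) (x : EuclideanSpace ℝ (Fin d)) {η : ℝ} (hη : 0 < η) :
    ∃ A, MeasurableSet A ∧ 0 < P A ∧ ∀ᵐ ω ∂P, ω ∈ A →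
      ‖linearizedFlow b (fun s ↦ X x s ω) T - linearizedFlow b γ T‖ ≤ η := by
  obtain ⟨Ψ, hΨ, hΨT⟩ := exists_linearizedFlow_eq hb.continuous_fderiv hγ T
  -- At `T = 0` there is no room for `0 < h < T`, but both flows are the identity.
  rcases eq_or_ne T 0 with rfl | hT0
  · refine ⟨Set.univ, MeasurableSet.univ, by simp, ?_⟩
    filter_upwards [(hX x).continuous_paths] with ω hω _
    obtain ⟨Φ, hΦ, hΦT⟩ := exists_linearizedFlow_eq hb.continuous_fderiv hω 0
    rw [hΦT, hΨT, NNReal.coe_zero, hΦ.1, hΨ.1, sub_self, norm_zero]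
    exact hη.le
  have hT : 0 < T := pos_iff_ne_zero.2 hT0
  obtain ⟨M, hM⟩ := (isCompact_Icc (a := (0 : ℝ≥0)) (b := T)).image hγ |>.isBounded.exists_norm_le
  replace hM : ∀ s ≤ T, ‖γ s‖ ≤ M := fun s hs ↦ hM _ ⟨s, ⟨bot_le, hs⟩, rfl⟩
  obtain ⟨K₁, hK₁0, hK₁⟩ := hb.exists_norm_fderiv_le (M + 1)
  -- `K₂` does not depend on the steering time, so `h` can be chosen small in terms of it below.
  obtain ⟨K₂, hK₂⟩ := exists_steering_bound hb hcontrol hcond x (γ 0)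
  obtain ⟨C, hC0, hC⟩ := hb.exists_norm_fderiv_sub_le
  set K := max K₁ K₂ with hKdef
  have hK0 : 0 < K := lt_max_of_lt_left hK₁0
  obtain ⟨N, hN0, hN⟩ : ∃ N : ℝ, 0 < N ∧ ∀ s ∈ Set.Icc (0 : ℝ) T, ‖Ψ s‖ ≤ N := by
    have hc : ContinuousOn Ψ (Set.Icc (0 : ℝ) T) := fun t ht ↦ (hΨ.2 t ht).continuousWithinAt
    obtain ⟨N, hN⟩ := (isCompact_Icc.image_of_continuousOn hc).isBounded.exists_norm_le
    exact ⟨max N 1, lt_max_of_lt_right one_pos,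
      fun s hs ↦ (hN _ ⟨s, hs, rfl⟩).trans (le_max_left _ _)⟩
  have hE0 := Real.exp_pos (K * T)
  set δ := η / 2 * K / (N * Real.exp (K * T)) with hδ
  have hδ0 : 0 < δ := by positivity
  have hδη : δ * N / K * Real.exp (K * T) = η / 2 := by rw [hδ]; field_simp
  -- Following `γ` and the delay each cost `ρ`, and `2 C ρ ≤ δ`; `C + 1` guards against `C = 0`.
  set ρ := δ / (2 * (C + 1)) with hρ
  have hρ0 : 0 < ρ := by positivity
  have hCρ : C * ρ ≤ δ / 2 := by
    have : (C + 1) * ρ = δ / 2 := by rw [hρ]; field_simp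
    nlinarith
  obtain ⟨τ, hτ0, hτ⟩ := Metric.uniformContinuousOn_iff.1
    ((isCompact_Icc (a := (0 : ℝ≥0)) (b := T)).uniformContinuousOn_of_continuous
      hγ.continuousOn) ρ hρ0
  obtain ⟨h, hhη, hhT, hhτ, hh0⟩ : ∃ h : ℝ≥0,
      2 * N * (Real.exp (K * h) - 1) * Real.exp (K * T) < η / 2 ∧ h < T ∧ (h : ℝ) < τ ∧ 0 < h := by
    have h1 : Tendsto (fun h : ℝ≥0 ↦ 2 * N * (Real.exp (K * h) - 1) * Real.exp (K * T))
        (𝓝[>] 0) (𝓝 0) := by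
      have : Continuous fun h : ℝ≥0 ↦ 2 * N * (Real.exp (K * h) - 1) * Real.exp (K * T) := by
        fun_prop
      simpa using (this.tendsto 0).mono_left nhdsWithin_le_nhds
    have h2 : Tendsto (fun h : ℝ≥0 ↦ (h : ℝ)) (𝓝[>] 0) (𝓝 0) := by
      simpa using (NNReal.continuous_coe.tendsto 0).mono_left nhdsWithin_le_nhds
    exact ((h1.eventually_lt_const (half_pos hη)).and ((eventually_nhdsWithin_of_eventually_nhds
      (eventually_lt_nhds hT)).and ((h2.eventually_lt_const hτ0).and self_mem_nhdsWithin))).exists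
  obtain ⟨A, hAm, hA0, hA⟩ := exists_measurableSet_follow (x := x) (h := h) (K := K) hB hb hX hγ
    hγT (fun ε hε ↦ (hK₂ h hh0 ε hε).trans_le (measure_mono fun ω hω ↦
      ⟨hω.1, fun s hs ↦ (hω.2 s hs).trans (le_max_right _ _)⟩))
    (ε := min 1 ρ) (lt_min one_pos hρ0)
  refine ⟨A, hAm, hA0, ?_⟩
  filter_upwards [hA, (hX x).continuous_paths] with ω hω hc hωA
  obtain ⟨hω1, hω2⟩ := hω hωA
  obtain ⟨Φ, hΦ, hΦT⟩ := exists_linearizedFlow_eq hb.continuous_fderiv hc T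
  rw [hΦT, hΨT]
  have hfollow : ∀ s, h ≤ s → s ≤ T → ‖X x s ω - γ (s - h)‖ ≤ min 1 ρ := fun s hs hsT ↦ by
    have := hω2 (s - h) (tsub_le_self.trans hsT)
    rwa [add_tsub_cancel_of_le hs] at this
  refine (norm_sub_le_of_isLinearizedFlow hhT.le hΦ hΨ hK0 hδ0.le hN0.le (fun s hs ↦ ?_)
    (fun s hs ↦ ?_) hN (fun s hs hsT ↦ ?_)).trans (by rw [hδη]; linarith)
  · rcases le_total s h with hsh | hsh
    · exact hω1 s hsh
    · refine (hK₁ _ ?_).trans (le_max_left _ _)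
      have h1 := norm_le_norm_add_norm_sub' (X x s ω) (γ (s - h))
      have h2 := hM (s - h) (tsub_le_self.trans hs)
      linarith [(hfollow s hsh hs).trans (min_le_left _ _)]
  · exact (hK₁ _ (by linarith [hM s hs])).trans (le_max_left _ _)
  · have h1 : ‖γ (s - h) - γ s‖ ≤ ρ := by
      rw [← dist_eq_norm]
      refine (hτ _ ⟨bot_le, tsub_le_self.trans hsT⟩ _ ⟨bot_le, hsT⟩ ?_).le
      rw [NNReal.dist_eq, NNReal.coe_sub hs, sub_sub_cancel_left, abs_neg,
        abs_of_nonneg h.coe_nonneg]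
      exact hhτ
    have h2 := (hfollow s hs hsT).trans (min_le_right _ _)
    have h3 : ‖X x s ω - γ s‖ ≤ ρ + ρ := by
      have : X x s ω - γ s = (X x s ω - γ (s - h)) + (γ (s - h) - γ s) := by abel
      rw [this]
      exact (norm_add_le _ _).trans (add_le_add h2 h1)
    calc _ ≤ C * ‖X x s ω - γ s‖ := hC _ _
      _ ≤ C * (ρ + ρ) := by gcongr
      _ ≤ δ := by linarith

lemma kappaAt_mono [IsProbabilityMeasure P] {p q : ℝ} (hp : 0 < p) (hpq : p ≤ q) (t : ℝ≥0)
    (x : EuclideanSpace ℝ (Fin d)) : kappaAt b P X p t x ≤ kappaAt b P X q t x :=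
  iSup₂_mono fun _ _ ↦ lintegral_rpow_le_of_exponent_le _ hp hpq

lemma kappaAt_le [IsProbabilityMeasure P] (hb : BasicConditions b) (t : ℝ≥0) :
    ∃ C : ℝ≥0∞, C ≠ ∞ ∧ ∀ x, ∀ p : ℝ, 0 < p → kappaAt b P X p t x ≤ C := by
  obtain ⟨L, -, hL⟩ := hb.one_sided_lipschitz
  refine ⟨ENNReal.ofReal (Real.exp (L * t)), ENNReal.ofReal_ne_top, fun x p hp ↦
    iSup₂_le fun v hv ↦ lintegral_rpow_le_of_forall_le (fun ω ↦ ?_) hp⟩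
  have := norm_linearizedFlow_apply_le hL hb.differentiable (fun s ↦ X x s ω) t v
  rw [mem_sphere_zero_iff_norm.1 hv, mul_one] at this
  rw [← ofReal_norm]
  exact ENNReal.ofReal_le_ofReal this

/-- For a unit vector `v`, `|Φ^X v| ≥ |Φ^γ v| - η` with positive probability from any `x`. The
abstract `u` covers both `kappaAt` and the larger `kappa`. -/
lemma kappaBar_le_of_tendsto [IsProbabilityMeasure P]
    (hB : IsFilteredBrownianMotion ℱ B P) (hX : ∀ x, IsSDESolution b σ ℱ B P x (X x))
    (hb : BasicConditions b) (hcontrol : IsControllable P X)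
    (hcond : (∃ M : ℝ, ∀ x, ‖fderiv ℝ b x‖ ≤ M) ∨ IsControllableInTubes P X)
    {t : ℝ≥0} (x : EuclideanSpace ℝ (Fin d)) {u : ℝ → ℝ≥0∞} {l : ℝ≥0∞} (hl : l ≠ ∞)
    (hu : Tendsto u atTop (𝓝 l)) (hκ : ∀ p, 0 < p → kappaAt b P X p t x ≤ u p) :
    kappaBar b P X t ≤ l := by
  refine iSup₂_le fun γ hγ ↦ ?_
  -- Stopping `γ` at `t` makes it continuous everywhere without changing its flow or admissibility.
  set γ' : ℝ≥0 → EuclideanSpace ℝ (Fin d) := fun s ↦ γ (min s t) with hγ'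
  have heq : ∀ s ≤ t, γ s = γ' s := fun s hs ↦ by simp [hγ', min_eq_left hs]
  have hγ'c : Continuous γ' :=
    hγ.1.comp_continuous (by fun_prop) fun s ↦ ⟨bot_le, min_le_right _ _⟩
  have hγ't : γ' ∈ admissiblePaths P X t := by
    refine ⟨hγ'c.continuousOn, fun ε hε ↦ (hγ.2 ε hε).trans_le (measure_mono fun ω hω s hs ↦ ?_)⟩
    rw [← heq 0 bot_le, ← heq s hs]
    exact hω s hs
  rw [linearizedFlow_congr heq]
  set Ψ := linearizedFlow b γ' t
  have key : ∀ v, ‖v‖ = 1 → ‖Ψ v‖ ≤ l.toReal := by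
    intro v hv
    refine le_of_forall_pos_sub_le fun η hη ↦ ?_
    obtain ⟨A, hAm, hA0, hA⟩ := exists_measurableSet_linearizedFlow_close hB hX hb hcontrol hcond
      hγ'c hγ't x hη
    have h1 : ENNReal.ofReal (‖Ψ v‖ - η) ≤ l := by
      refine le_of_tendsto_lintegral_rpow
        (f := fun ω ↦ ‖linearizedFlow b (fun s ↦ X x s ω) t v‖ₑ) ENNReal.ofReal_ne_top hu
        (fun p hp ↦ le_trans (le_iSup₂_of_le v (mem_sphere_zero_iff_norm.2 hv) le_rfl) (hκ p hp))
        hAm hA0 ?_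
      filter_upwards [hA] with ω hω hωA
      rw [← ofReal_norm]
      refine ENNReal.ofReal_le_ofReal ?_
      have h2 := (linearizedFlow b (fun s ↦ X x s ω) t - Ψ).le_of_opNorm_le (hω hωA) v
      rw [hv, mul_one, sub_apply] at h2
      have h3 := norm_le_norm_add_norm_sub (linearizedFlow b (fun s ↦ X x s ω) t v) (Ψ v)
      linarith
    exact (ENNReal.ofReal_le_iff_le_toReal hl).1 h1
  rw [← ofReal_norm, ENNReal.ofReal_le_iff_le_toReal hl]
  exact ContinuousLinearMap.opNorm_le_of_unit_norm ENNReal.toReal_nonneg key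

end Main

theorem proposition5 {Ω : Type*} {mΩ : MeasurableSpace Ω} (P : Measure Ω) [IsProbabilityMeasure P]
    {d : ℕ} (b : EuclideanSpace ℝ (Fin d) → EuclideanSpace ℝ (Fin d))
    (σ : Matrix (Fin d) (Fin d) ℝ)
    (ℱ : Filtration ℝ≥0 mΩ) (B : ℝ≥0 → Ω → EuclideanSpace ℝ (Fin d))
    (hB : IsFilteredBrownianMotion ℱ B P)
    (X : EuclideanSpace ℝ (Fin d) → ℝ≥0 → Ω → EuclideanSpace ℝ (Fin d))
    (hX : ∀ x, IsSDESolution b σ ℱ B P x (X x))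
    (hb : BasicConditions b)
    (hcontrol : IsControllable P X)
    (hcond : (∃ M : ℝ, ∀ x, ‖fderiv ℝ b x‖ ≤ M) ∨ IsControllableInTubes P X)
    (t : ℝ≥0) :
    (∀ x : EuclideanSpace ℝ (Fin d), ∃ l : ℝ≥0∞, l ≠ ∞ ∧
      Tendsto (fun p : ℝ ↦ kappaAt b P X p t x) atTop (𝓝 l) ∧ kappaBar b P X t ≤ l) ∧
    (∃ l : ℝ≥0∞, l ≠ ∞ ∧
      Tendsto (fun p : ℝ ↦ kappa b P X p t) atTop (𝓝 l) ∧ kappaBar b P X t ≤ l) := by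

  obtain ⟨C, hC, hκC⟩ := kappaAt_le (P := P) (X := X) hb t
  constructor
  · intro x
    obtain ⟨l, hl, hlim⟩ := exists_tendsto_of_monotone_of_le (u := fun p ↦ kappaAt b P X p t x) hC
      (fun p q hp hpq ↦ kappaAt_mono hp hpq t x) (hκC x)
    exact ⟨l, hl, hlim,
      kappaBar_le_of_tendsto hB hX hb hcontrol hcond x hl hlim fun _ _ ↦ le_rfl⟩
  · obtain ⟨l, hl, hlim⟩ := exists_tendsto_of_monotone_of_le (u := fun p ↦ kappa b P X p t) hC
      (fun p q hp hpq ↦ iSup_mono fun x ↦ kappaAt_mono hp hpq t x)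
      (fun p hp ↦ iSup_le fun x ↦ hκC x p hp)
    exact ⟨l, hl, hlim, kappaBar_le_of_tendsto hB hX hb hcontrol hcond 0 hl hlim
      fun p _ ↦ le_iSup (fun x ↦ kappaAt b P X p t x) 0⟩
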